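/- Let $C \subseteq \mathbb{R}^n$ be nonempty, compact and convex, and let $F : C \to \mathbb{R}^n$ be a $C^1$ map that is $\mu$-strongly monotone on $C$ for some $\mu > 0$, i.e. $\langle F(x) - F(y), x - y\rangle \ge \mu \|x - y\|^2$ for all $x, y \in C$. Then the variational inequality of finding $x \in C$ with $\langle F(x), z - x\rangle \ge 0$ for all $z \in C$ has exactly one solution $x^*$. Moreover, let $(\gamma_k)_{k\ge 1}$ be any step sizes with $\gamma_k \in (0,1]$, $\gamma_k \to 0$ and $\sum_{k=1}^\infty \gamma_k = \infty$, and let $(x_k)_{k \ge 0}$ be any sequence generated by the Frank--Wolfe iteration $$x_0 \in C, \qquad x_{k+1} = x_k + \gamma_{k+1}(s_k - x_k), \qquad s_k \in \operatorname*{arg\,min}_{s \in C} \langle F(x_k), s\rangle \qquad (k \ge 0),$$ with an arbitrary choice of the minimizers $s_k$. Then $x_k \to x^*$ as $k \to \infty$. In particular, this holds for $\gamma_k = 1/k$, that is, every sequence generated by generalized fictitious play converges to $x^*$ (Hammond's conjecture asserts this when $C$ is a polytope). -/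

import Mathlib

open Filter Topology

namespace FrankWolfeVI

/-- The linear minimization oracle `β(π) = argmin_{s ∈ C} ⟪π, s⟫`. -/
def lmo {n : ℕ} (C : Set (EuclideanSpace ℝ (Fin n))) (π : EuclideanSpace ℝ (Fin n)) :
    Set (EuclideanSpace ℝ (Fin n)) :=
  {s | s ∈ C ∧ ∀ z ∈ C, inner ℝ π s ≤ inner ℝ π z}

/-- The solution set `SOL(C, F)` of the variational inequality. -/
def solutionSet {n : ℕ} (C : Set (EuclideanSpace ℝ (Fin n)))
    (F : EuclideanSpace ℝ (Fin n) → EuclideanSpace ℝ (Fin n)) :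
    Set (EuclideanSpace ℝ (Fin n)) :=
  {x | x ∈ C ∧ ∀ z ∈ C, 0 ≤ inner ℝ (F x) (z - x)}

/-- `F` is `μ`-strongly monotone on `C`. -/
def StronglyMonotoneOn {n : ℕ} (μ : ℝ) (C : Set (EuclideanSpace ℝ (Fin n)))
    (F : EuclideanSpace ℝ (Fin n) → EuclideanSpace ℝ (Fin n)) : Prop :=
  ∀ x ∈ C, ∀ y ∈ C, μ * ‖x - y‖ ^ 2 ≤ inner ℝ (F x - F y) (x - y)

/-- Admissible step sizes `γ₁, γ₂, …` (the value `γ 0` is never used): they lie in `(0, 1]`,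
tend to zero, and have divergent sum. -/
structure IsStepSize (γ : ℕ → ℝ) : Prop where
  mem_Ioc : ∀ k, 1 ≤ k → γ k ∈ Set.Ioc (0 : ℝ) 1
  tendsto_zero : Tendsto γ atTop (𝓝 0)
  sum_tendsto : Tendsto (fun N : ℕ => ∑ k ∈ Finset.Icc 1 N, γ k) atTop atTop

/-- `x` is a sequence generated by the Frank-Wolfe iteration
`x_{k+1} = x_k + γ_{k+1} (s_k - x_k)`, `s_k ∈ β(F(x_k))`, `x_0 ∈ C`,
for some choice of the minimizers `s_k`. -/
def IsFrankWolfe {n : ℕ} (C : Set (EuclideanSpace ℝ (Fin n)))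
    (F : EuclideanSpace ℝ (Fin n) → EuclideanSpace ℝ (Fin n))
    (γ : ℕ → ℝ) (x : ℕ → EuclideanSpace ℝ (Fin n)) : Prop :=
  x 0 ∈ C ∧ ∃ s : ℕ → EuclideanSpace ℝ (Fin n),
    ∀ k, s k ∈ lmo C (F (x k)) ∧ x (k + 1) = x k + γ (k + 1) • (s k - x k)

/-- Generalized fictitious play: the Frank-Wolfe iteration with step sizes `γ_k = 1 / k`. -/
def IsGeneralizedFictitiousPlay {n : ℕ} (C : Set (EuclideanSpace ℝ (Fin n)))
    (F : EuclideanSpace ℝ (Fin n) → EuclideanSpace ℝ (Fin n))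
    (x : ℕ → EuclideanSpace ℝ (Fin n)) : Prop :=
  IsFrankWolfe C F (fun k => 1 / (k : ℝ)) x

end FrankWolfeVI

/-!
The proof follows the continuous-time dynamics `Y' ∈ lmo C (F Y) - Y` behind the Frank-Wolfe
iteration, with the gap function `gap C F x = max_{z ∈ C} ⟪F x, x - z⟫` as Lyapunov function. The gap
is nonnegative on `C` and vanishes exactly at the solutions of the variational inequality.

Let `Λ` be the set of cluster points of the iterates `x_k`, and give `x_k` the time
`γ₁ + ⋯ + γ_k`. Through each `y ∈ Λ` passes a Lipschitz curve `Y : ℝ → Λ` with `Y 0 = y`, obtained as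
the limit, along an ultrafilter that carries `x_k` to `y`, of the iterates shifted in time by `t`
(`exists_limit_curve`). Over a time span `τ` the iterates move by `τ • (s̄ - x_k)` up to `O(τ²)`, where
the average `s̄ ∈ C` of the oracle answers minimizes `⟪F x_k, ·⟫` up to `O(τ)`
(`IsFrankWolfe.stepEstimate`), and this passes to the limit. So `Y t + Y' t` is an exact minimizer
wherever `Y` is differentiable.

By Rademacher's theorem in dimension one, `Y`, `F ∘ Y` and `gap ∘ Y` are differentiable almost
everywhere. At such a time `t`, with `w = Y t + Y' t`, the function `t' ↦ ⟪F (Y t'), Y t' - w⟫` touches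
`gap ∘ Y` from below, so the two derivatives agree; since `F` is monotone, `⟪(F ∘ Y)' t, Y' t⟫ ≥ 0`, and
therefore `(gap ∘ Y)' t ≤ -gap (Y t)` (`deriv_gap_le`). Working in the limit is what removes the effect
of the oracle answers jumping between minimizers from one step to the next.

Now let `y` maximize the gap over the compact set `Λ`. The curve through `y` stays in `Λ` and the gap is
antitone along it, so the gap is constant on `(-∞, 0]`; its derivative there is zero, whence
`gap y ≤ 0`. Thus every cluster point solves the variational inequality. Strong monotonicity makes the
solution unique, so the iterates converge to it. Existence also follows, by running the iteration with
step sizes `1 / k`.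
-/

namespace FrankWolfeVI

open MeasureTheory Set
open scoped NNReal RealInnerProductSpace

/-! ### The gap function -/

/-- The gap function `max_{z ∈ C} ⟪F x, x - z⟫` of the variational inequality, written as a supremum;
for nonempty compact `C` it is attained. -/
noncomputable def gap {n : ℕ} (C : Set (EuclideanSpace ℝ (Fin n)))
    (F : EuclideanSpace ℝ (Fin n) → EuclideanSpace ℝ (Fin n)) (x : EuclideanSpace ℝ (Fin n)) : ℝ :=
  sSup ((fun z => ⟪F x, x - z⟫) '' C)

section

variable {n : ℕ} {C : Set (EuclideanSpace ℝ (Fin n))}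
  {F : EuclideanSpace ℝ (Fin n) → EuclideanSpace ℝ (Fin n)}

theorem inner_le_gap (hC : IsCompact C) (x : EuclideanSpace ℝ (Fin n))
    {z : EuclideanSpace ℝ (Fin n)} (hz : z ∈ C) : ⟪F x, x - z⟫ ≤ gap C F x :=
  le_csSup (hC.image (by fun_prop)).bddAbove (mem_image_of_mem _ hz)

theorem exists_gap_eq (hC : IsCompact C) (hne : C.Nonempty) (x : EuclideanSpace ℝ (Fin n)) :
    ∃ z ∈ C, gap C F x = ⟪F x, x - z⟫ := by
  obtain ⟨z, hz, h⟩ := (hC.image (f := fun z => ⟪F x, x - z⟫) (by fun_prop)).sSup_mem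
    (hne.image _)
  exact ⟨z, hz, h.symm⟩

theorem mem_solutionSet_of_gap_le_zero (hC : IsCompact C) {x : EuclideanSpace ℝ (Fin n)}
    (hx : x ∈ C) (h : gap C F x ≤ 0) : x ∈ solutionSet C F := by
  refine ⟨hx, fun z hz => ?_⟩
  have := inner_le_gap (F := F) hC x hz
  rw [← neg_sub z x, inner_neg_right] at this
  linarith

theorem exists_lipschitzOnWith_gap (hC : IsCompact C) (hne : C.Nonempty) {K : ℝ≥0}
    (hF : LipschitzOnWith K F C) : ∃ L : ℝ≥0, LipschitzOnWith L (gap C F) C := by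
  obtain ⟨M, hM⟩ := hC.exists_bound_of_continuousOn hF.continuousOn
  have hM0 : 0 ≤ M := (norm_nonneg _).trans (hM _ hne.some_mem)
  refine ⟨K * (Metric.diam C).toNNReal + M.toNNReal, LipschitzOnWith.of_le_add_mul _ ?_⟩
  intro x hx y hy
  obtain ⟨z, hz, hxz⟩ := exists_gap_eq (F := F) hC hne x
  have h1 : ⟪F x - F y, x - z⟫ ≤ K * dist x y * Metric.diam C := by
    refine (real_inner_le_norm _ _).trans ?_
    rw [← dist_eq_norm, ← dist_eq_norm]
    exact mul_le_mul (hF.dist_le_mul x hx y hy) (Metric.dist_le_diam_of_mem hC.isBounded hx hz)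
      dist_nonneg (by positivity)
  have h2 : ⟪F y, x - y⟫ ≤ M * dist x y := by
    refine (real_inner_le_norm _ _).trans ?_
    rw [← dist_eq_norm]
    exact mul_le_mul_of_nonneg_right (hM y hy) dist_nonneg
  have h3 : ⟪F x, x - z⟫ = ⟪F x - F y, x - z⟫ + ⟪F y, x - y⟫ + ⟪F y, y - z⟫ := by
    simp only [inner_sub_left, inner_sub_right]; ring
  have h4 := inner_le_gap (F := F) hC y hz
  push_cast
  rw [Real.coe_toNNReal _ Metric.diam_nonneg, Real.coe_toNNReal _ hM0]
  nlinarith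

theorem StronglyMonotoneOn.solutionSet_subsingleton {μ : ℝ} (hμ : 0 < μ)
    (hF : StronglyMonotoneOn μ C F) : (solutionSet C F).Subsingleton := by
  rintro x ⟨hx, hx'⟩ y ⟨hy, hy'⟩
  have h1 := hx' y hy
  have h2 := hy' x hx
  have h3 := hF x hx y hy
  rw [← neg_sub x y, inner_neg_right] at h1
  rw [inner_sub_left] at h3
  have h4 : ‖x - y‖ ^ 2 ≤ 0 := by
    by_contra! h
    nlinarith
  exact sub_eq_zero.1 (norm_eq_zero.1 (pow_eq_zero_iff two_ne_zero |>.1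
    (le_antisymm h4 (sq_nonneg _))))

/-! ### Estimates over a time span -/

/-- The displacement from `a` to `b` during a time `τ` is that of the Frank-Wolfe dynamics up to an
error of second order: it is `τ • (s - a)` up to `c τ²`, for a point `s ∈ C` that minimizes
`⟪F a, ·⟫` over `C` up to `c τ`. -/
def StepEstimate {n : ℕ} (C : Set (EuclideanSpace ℝ (Fin n)))
    (F : EuclideanSpace ℝ (Fin n) → EuclideanSpace ℝ (Fin n)) (c τ : ℝ)
    (a b : EuclideanSpace ℝ (Fin n)) : Prop :=
  ‖b - a‖ ≤ c * τ ∧ ∃ s ∈ C, ‖b - a - τ • (s - a)‖ ≤ c * τ ^ 2 ∧ ∀ z ∈ C, ⟪F a, s - z⟫ ≤ c * τ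

/-- The time `γ₁ + ⋯ + γ_k` at which the iteration reaches `x_k`. -/
noncomputable def elapsedTime (γ : ℕ → ℝ) (k : ℕ) : ℝ := ∑ i ∈ Finset.Icc 1 k, γ i

theorem elapsedTime_succ (γ : ℕ → ℝ) (k : ℕ) :
    elapsedTime γ (k + 1) = elapsedTime γ k + γ (k + 1) :=
  Finset.sum_Icc_succ_top (by omega) _

theorem IsStepSize.strictMono_elapsedTime {γ : ℕ → ℝ} (hγ : IsStepSize γ) :
    StrictMono (elapsedTime γ) :=
  strictMono_nat_of_lt_succ fun k => by
    have := (hγ.mem_Ioc (k + 1) (by omega)).1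
    rw [elapsedTime_succ]; linarith

theorem IsFrankWolfe.mem {γ : ℕ → ℝ} {x : ℕ → EuclideanSpace ℝ (Fin n)} (hconv : Convex ℝ C)
    (hγ : IsStepSize γ) (hx : IsFrankWolfe C F γ x) (k : ℕ) : x k ∈ C := by
  obtain ⟨h0, s, hs⟩ := hx
  induction k with
  | zero => exact h0
  | succ k ih =>
    have h := hγ.mem_Ioc (k + 1) (by omega)
    rw [(hs k).2]
    exact hconv.add_smul_sub_mem ih (hs k).1.1 ⟨h.1.le, h.2⟩

/-- The point `s` of the estimate is the average of the oracle answers, weighted by the step sizes. -/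
theorem IsFrankWolfe.stepEstimate {γ : ℕ → ℝ} {x : ℕ → EuclideanSpace ℝ (Fin n)} {K : ℝ≥0} {R : ℝ}
    (hconv : Convex ℝ C) (hR : ∀ a ∈ C, ∀ b ∈ C, ‖a - b‖ ≤ R) (hF : LipschitzOnWith K F C)
    (hγ : IsStepSize γ) (hx : IsFrankWolfe C F γ x) {i j : ℕ} (hij : i ≤ j) :
    StepEstimate C F (R + K * R * R) (elapsedTime γ j - elapsedTime γ i) (x i) (x j) := by
  have hxC := hx.mem hconv hγ
  obtain ⟨-, s, hs⟩ := hx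
  have hR0 : 0 ≤ R := (norm_nonneg _).trans (hR _ (hxC 0) _ (hxC 0))
  have hKR : 0 ≤ K * R * R := by positivity
  -- The first two bounds hold with `R`, the last with `K * R * R`; the sum serves all three.
  suffices h : ‖x j - x i‖ ≤ R * (elapsedTime γ j - elapsedTime γ i) ∧ ∃ s ∈ C,
      ‖x j - x i - (elapsedTime γ j - elapsedTime γ i) • (s - x i)‖
        ≤ R * (elapsedTime γ j - elapsedTime γ i) ^ 2 ∧
      ∀ z ∈ C, ⟪F (x i), s - z⟫ ≤ K * R * R * (elapsedTime γ j - elapsedTime γ i) by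
    have hτ : 0 ≤ elapsedTime γ j - elapsedTime γ i :=
      sub_nonneg.2 (hγ.strictMono_elapsedTime.monotone hij)
    obtain ⟨h1, s, hsC, h2, h3⟩ := h
    refine ⟨h1.trans (by nlinarith), s, hsC, h2.trans ?_, fun z hz => (h3 z hz).trans ?_⟩
    · nlinarith [sq_nonneg (elapsedTime γ j - elapsedTime γ i)]
    · nlinarith
  induction j, hij using Nat.le_induction with
  | base =>
    refine ⟨by simp, s i, (hs i).1.1, by simp, fun z hz => ?_⟩
    have := (hs i).1.2 z hz
    rw [inner_sub_right]
    simpa using this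
  | succ j hij ih =>
    obtain ⟨h1, r, hrC, h2, h3⟩ := ih
    have hg := hγ.mem_Ioc (j + 1) (by omega)
    have hτ : 0 ≤ elapsedTime γ j - elapsedTime γ i :=
      sub_nonneg.2 (hγ.strictMono_elapsedTime.monotone hij)
    have e : elapsedTime γ (j + 1) - elapsedTime γ i
        = (elapsedTime γ j - elapsedTime γ i) + γ (j + 1) := by rw [elapsedTime_succ]; ring
    have hstep := (hs j).2
    rw [e]
    generalize elapsedTime γ j - elapsedTime γ i = τ at *
    generalize γ (j + 1) = g at *
    have hpos : 0 < τ + g := by linarith [hg.1]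
    -- `s j` minimizes for `F (x j)`, which is within `K * (R * τ)` of `F (x i)`.
    have hsj : ∀ z ∈ C, ⟪F (x i), s j - z⟫ ≤ K * R * R * τ := by
      intro z hz
      have a1 : ⟪F (x j), s j - z⟫ ≤ 0 := by
        rw [inner_sub_right]; linarith [(hs j).1.2 z hz]
      have a2 : ⟪F (x i) - F (x j), s j - z⟫ ≤ K * (R * τ) * R := by
        refine (real_inner_le_norm _ _).trans ?_
        refine mul_le_mul ?_ (hR _ (hs j).1.1 _ hz) (norm_nonneg _) (by positivity)
        refine (hF.norm_sub_le (hxC i) (hxC j)).trans ?_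
        rw [norm_sub_rev]
        exact mul_le_mul_of_nonneg_left h1 K.2
      rw [inner_sub_left] at a2
      linarith
    refine ⟨?_, (τ / (τ + g)) • r + (g / (τ + g)) • s j, ?_, ?_, ?_⟩
    · calc ‖x (j + 1) - x i‖ = ‖(x j - x i) + g • (s j - x j)‖ := by rw [hstep]; congr 1; abel
        _ ≤ ‖x j - x i‖ + ‖g • (s j - x j)‖ := norm_add_le _ _
        _ ≤ R * τ + g * R := by
          rw [norm_smul, Real.norm_of_nonneg hg.1.le]
          exact add_le_add h1 (mul_le_mul_of_nonneg_left (hR _ (hs j).1.1 _ (hxC j)) hg.1.le)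
        _ = R * (τ + g) := by ring
    · exact hconv hrC (hs j).1.1 (by positivity) (div_nonneg hg.1.le hpos.le)
        (by rw [← add_div, div_self hpos.ne'])
    · have e2 : x (j + 1) - x i
          - (τ + g) • ((τ / (τ + g)) • r + (g / (τ + g)) • s j - x i)
          = (x j - x i - τ • (r - x i)) - g • (x j - x i) := by
        rw [hstep]
        match_scalars <;> field_simp <;> ring
      rw [e2]
      refine (norm_sub_le _ _).trans ?_
      rw [norm_smul, Real.norm_of_nonneg hg.1.le]
      have := mul_le_mul_of_nonneg_left h1 hg.1.le
      nlinarith [mul_nonneg (mul_nonneg hR0 hτ) hg.1.le, mul_nonneg hR0 (sq_nonneg g)]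
    · intro z hz
      have e3 : (τ / (τ + g)) • r + (g / (τ + g)) • s j - z
          = (τ / (τ + g)) • (r - z) + (g / (τ + g)) • (s j - z) := by
        have : z = (τ / (τ + g)) • z + (g / (τ + g)) • z := by
          rw [← add_smul, ← add_div, div_self hpos.ne', one_smul]
        nth_rewrite 1 [this]
        module
      rw [e3, inner_add_right, inner_smul_right, inner_smul_right]
      calc _ ≤ τ / (τ + g) * (K * R * R * τ) + g / (τ + g) * (K * R * R * τ) :=
            add_le_add (mul_le_mul_of_nonneg_left (h3 z hz) (by positivity))
              (mul_le_mul_of_nonneg_left (hsj z hz) (div_nonneg hg.1.le hpos.le))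
        _ = K * R * R * τ := by rw [← add_mul, ← add_div, div_self hpos.ne', one_mul]
        _ ≤ K * R * R * (τ + g) := mul_le_mul_of_nonneg_left (by linarith [hg.1]) hKR

theorem StepEstimate.of_tendsto {ι : Type*} {U : Ultrafilter ι} (hC : IsCompact C)
    {c τ : ℝ} {a b : EuclideanSpace ℝ (Fin n)} {τ' : ι → ℝ} {a' b' : ι → EuclideanSpace ℝ (Fin n)}
    (hτ : Tendsto τ' U (𝓝 τ)) (ha : Tendsto a' U (𝓝 a)) (hb : Tendsto b' U (𝓝 b))
    (hFa : Tendsto (fun i => F (a' i)) U (𝓝 (F a)))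
    (h : ∀ᶠ i in (U : Filter ι), StepEstimate C F c (τ' i) (a' i) (b' i)) :
    StepEstimate C F c τ a b := by
  refine ⟨le_of_tendsto_of_tendsto (hb.sub ha).norm (hτ.const_mul c) (h.mono fun i hi => hi.1), ?_⟩
  have h' : ∀ i, ∃ s, StepEstimate C F c (τ' i) (a' i) (b' i) →
      s ∈ C ∧ ‖b' i - a' i - τ' i • (s - a' i)‖ ≤ c * τ' i ^ 2 ∧
        ∀ z ∈ C, ⟪F (a' i), s - z⟫ ≤ c * τ' i := fun i => by
    by_cases hi : StepEstimate C F c (τ' i) (a' i) (b' i)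
    · obtain ⟨s, hs⟩ := hi.2
      exact ⟨s, fun _ => hs⟩
    · exact ⟨0, fun hi' => absurd hi' hi⟩
  choose s' hs' using h'
  have hs : ∀ᶠ i in (U : Filter ι), _ := h.mono fun i hi => hs' i hi
  obtain ⟨s, hsC, hlim⟩ := hC.ultrafilter_le_nhds (U.map s')
    (le_principal_iff.2 (hs.mono fun i hi => hi.1))
  replace hlim : Tendsto s' U (𝓝 s) := hlim
  refine ⟨s, hsC, ?_, fun z hz => ?_⟩
  · exact le_of_tendsto_of_tendsto ((hb.sub ha).sub (hτ.smul (hlim.sub ha))).norm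
      ((hτ.pow 2).const_mul c) (hs.mono fun i hi => hi.2.1)
  · exact le_of_tendsto_of_tendsto (hFa.inner (hlim.sub tendsto_const_nhds)) (hτ.const_mul c)
      (hs.mono fun i hi => hi.2.2 z hz)

/-! ### Limit curves through cluster points -/

/-- Every cluster point of the iterates lies on a curve of cluster points, defined for all times, that
follows the Frank-Wolfe dynamics. -/
theorem exists_limit_curve {γ : ℕ → ℝ} {x : ℕ → EuclideanSpace ℝ (Fin n)} {K : ℝ≥0} {R : ℝ}
    (hC : IsCompact C) (hconv : Convex ℝ C) (hR : ∀ a ∈ C, ∀ b ∈ C, ‖a - b‖ ≤ R)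
    (hF : LipschitzOnWith K F C) (hγ : IsStepSize γ) (hx : IsFrankWolfe C F γ x)
    {y : EuclideanSpace ℝ (Fin n)} (hy : MapClusterPt y atTop x) :
    ∃ Y : ℝ → EuclideanSpace ℝ (Fin n), Y 0 = y ∧ (∀ t, MapClusterPt (Y t) atTop x) ∧
      ∀ t t', t ≤ t' → StepEstimate C F (R + K * R * R) (t' - t) (Y t) (Y t') := by
  obtain ⟨U, hU, hUy⟩ := mapClusterPt_iff_ultrafilter.1 hy
  have hxC := hx.mem hconv hγ
  have hmono := hγ.strictMono_elapsedTime
  have htop : Tendsto (elapsedTime γ) atTop atTop := hγ.sum_tendsto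
  -- `N k t` is the first index whose time is at least `t` later than that of `k`.
  have hN : ∀ (k : ℕ) (t : ℝ), ∃ j, elapsedTime γ k + t ≤ elapsedTime γ j ∧
      ∀ i < j, elapsedTime γ i < elapsedTime γ k + t := fun k t => by
    classical
    have h : ∃ j, elapsedTime γ k + t ≤ elapsedTime γ j := (htop.eventually_ge_atTop _).exists
    exact ⟨Nat.find h, Nat.find_spec h, fun i hi => not_le.1 (Nat.find_min h hi)⟩
  choose N hN1 hN2 using hN
  have hNmono : ∀ k t t', t ≤ t' → N k t ≤ N k t' := fun k t t' htt' => by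
    by_contra! h
    linarith [hN2 k t _ h, hN1 k t']
  have hN0 : ∀ k, N k 0 = k := fun k => by
    refine le_antisymm ?_ ?_
    · by_contra! h
      linarith [hN2 k 0 _ h]
    · exact hmono.le_iff_le.1 (by linarith [hN1 k 0])
  have hNtop : ∀ t, Tendsto (fun k => N k t) atTop atTop := fun t => by
    refine tendsto_atTop.2 fun b => ?_
    filter_upwards [htop.eventually_ge_atTop (elapsedTime γ b - t)] with k hk
    exact hmono.le_iff_le.1 (by linarith [hN1 k t])
  have hτ : ∀ t, Tendsto (fun k => elapsedTime γ (N k t) - elapsedTime γ k) atTop (𝓝 t) := fun t => by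
    have hup : Tendsto (fun k => t + γ (N k t)) atTop (𝓝 t) := by
      simpa using (hγ.tendsto_zero.comp (hNtop t)).const_add t
    refine tendsto_of_tendsto_of_tendsto_of_le_of_le' tendsto_const_nhds hup
      (Eventually.of_forall fun k => by linarith [hN1 k t]) ?_
    filter_upwards [(hNtop t).eventually_ge_atTop 1] with k hk
    have h1 := hN2 k t (N k t - 1) (by omega)
    have h2 := elapsedTime_succ γ (N k t - 1)
    rw [Nat.sub_add_cancel hk] at h2
    linarith
  have hlim : ∀ t, ∃ a ∈ C, Tendsto (fun k => x (N k t)) U (𝓝 a) := fun t =>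
    hC.ultrafilter_le_nhds (U.map fun k => x (N k t))
      (le_principal_iff.2 (Filter.univ_mem' (f := U) fun k => hxC (N k t)))
  choose Y hYC hY using hlim
  refine ⟨Y, ?_, fun t => ?_, fun t t' htt' => ?_⟩
  · have := hY 0
    simp only [hN0] at this
    exact tendsto_nhds_unique this hUy
  · exact mapClusterPt_iff_ultrafilter.2 ⟨U.map fun k => N k t, (hNtop t).mono_left hU, hY t⟩
  · have hFt : Tendsto (fun k => F (x (N k t))) U (𝓝 (F (Y t))) :=
      (hF.continuousOn _ (hYC t)).tendsto.comp
        (tendsto_nhdsWithin_iff.2 ⟨hY t, Eventually.of_forall fun k => hxC _⟩)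
    refine StepEstimate.of_tendsto hC ?_ (hY t) (hY t') hFt (Eventually.of_forall fun k =>
      hx.stepEstimate hconv hR hF hγ (hNmono k t t' htt'))
    exact (((hτ t').sub (hτ t)).congr fun k => by ring).mono_left hU

theorem lipschitzWith_of_stepEstimate {c : ℝ} (hc : 0 ≤ c) {Y : ℝ → EuclideanSpace ℝ (Fin n)}
    (hY : ∀ t t', t ≤ t' → StepEstimate C F c (t' - t) (Y t) (Y t')) :
    LipschitzWith c.toNNReal Y := by
  refine LipschitzWith.of_dist_le_mul fun t t' => ?_
  rw [Real.coe_toNNReal _ hc]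
  rcases le_total t t' with h | h
  · rw [dist_comm, dist_eq_norm, dist_comm, Real.dist_eq, abs_of_nonneg (sub_nonneg.2 h)]
    exact (hY t t' h).1
  · rw [dist_eq_norm, Real.dist_eq, abs_of_nonneg (sub_nonneg.2 h)]
    exact (hY t' t h).1

/-- Where a limit curve is differentiable, it satisfies the differential inclusion
`Y' t ∈ lmo C (F (Y t)) - Y t`. -/
theorem add_deriv_mem_lmo {c : ℝ} (hC : IsCompact C) {Y : ℝ → EuclideanSpace ℝ (Fin n)}
    (hY : ∀ t t', t ≤ t' → StepEstimate C F c (t' - t) (Y t) (Y t')) {t : ℝ}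
    {v : EuclideanSpace ℝ (Fin n)} (hv : HasDerivAt Y v t) : Y t + v ∈ lmo C (F (Y t)) := by
  have h' : ∀ t', ∃ s, t < t' → s ∈ C ∧ ‖Y t' - Y t - (t' - t) • (s - Y t)‖ ≤ c * (t' - t) ^ 2 ∧
      ∀ z ∈ C, ⟪F (Y t), s - z⟫ ≤ c * (t' - t) := fun t' => by
    by_cases ht : t < t'
    · obtain ⟨s, hs⟩ := (hY t t' ht.le).2
      exact ⟨s, fun _ => hs⟩
    · exact ⟨0, fun h => absurd h ht⟩
  choose s hs using h'
  have hmem : ∀ᶠ t' in 𝓝[>] t, t < t' := eventually_mem_nhdsWithin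
  have hτ : Tendsto (fun t' => c * (t' - t)) (𝓝[>] t) (𝓝 0) := by
    have : Tendsto (fun t' => c * (t' - t)) (𝓝 t) (𝓝 (c * (t - t))) :=
      Continuous.tendsto (by fun_prop) t
    simpa using this.mono_left nhdsWithin_le_nhds
  have hslope : Tendsto (slope Y t) (𝓝[>] t) (𝓝 v) :=
    (hasDerivAt_iff_tendsto_slope.1 hv).mono_left
      (nhdsWithin_mono _ fun _ h => ne_of_gt h)
  have hdiff : Tendsto (fun t' => slope Y t t' - (s t' - Y t)) (𝓝[>] t) (𝓝 0) := by
    refine squeeze_zero_norm' ?_ hτ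
    filter_upwards [hmem] with t' ht'
    have hpos : 0 < t' - t := sub_pos.2 ht'
    have e : slope Y t t' - (s t' - Y t)
        = (t' - t)⁻¹ • (Y t' - Y t - (t' - t) • (s t' - Y t)) := by
      rw [smul_sub _ _ ((t' - t) • _), smul_smul, inv_mul_cancel₀ hpos.ne', one_smul, slope_def_module]
    rw [e, norm_smul, norm_inv, Real.norm_of_nonneg hpos.le, inv_mul_le_iff₀ hpos]
    exact (hs t' ht').2.1.trans (le_of_eq (by ring))
  have hlim : Tendsto s (𝓝[>] t) (𝓝 (Y t + v)) := by
    have := (hslope.sub hdiff).const_add (Y t)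
    simpa using this
  refine ⟨hC.isClosed.mem_of_tendsto hlim (hmem.mono fun t' ht' => (hs t' ht').1), fun z hz => ?_⟩
  have : ⟪F (Y t), Y t + v - z⟫ ≤ 0 :=
    le_of_tendsto_of_tendsto (tendsto_const_nhds.inner (hlim.sub tendsto_const_nhds)) hτ
      (hmem.mono fun t' ht' => (hs t' ht').2.2 z hz)
  rw [inner_sub_right] at this
  linarith

/-! ### Decay of the gap -/

/-- The decay of the gap along a solution of the differential inclusion. Only monotonicity of `F` enters,
and no derivative of `F` itself: the derivative of `F ∘ Y` suffices. -/
theorem deriv_gap_le (hC : IsCompact C) {Y : ℝ → EuclideanSpace ℝ (Fin n)} (hYC : ∀ t, Y t ∈ C)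
    (hF : ∀ a ∈ C, ∀ b ∈ C, 0 ≤ ⟪F a - F b, a - b⟫) {t φ' : ℝ} {v p : EuclideanSpace ℝ (Fin n)}
    (hv : HasDerivAt Y v t) (hp : HasDerivAt (fun t => F (Y t)) p t)
    (hφ : HasDerivAt (fun t => gap C F (Y t)) φ' t) (hw : Y t + v ∈ lmo C (F (Y t))) :
    φ' ≤ -gap C F (Y t) := by
  have hgap : gap C F (Y t) = -⟪F (Y t), v⟫ := by
    refine le_antisymm ?_ ?_
    · obtain ⟨z, hz, h⟩ := exists_gap_eq (F := F) hC ⟨_, hYC t⟩ (Y t)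
      have := hw.2 z hz
      rw [h, inner_sub_right]
      rw [inner_add_right] at this
      linarith
    · have := inner_le_gap (F := F) hC (Y t) hw.1
      rwa [sub_add_cancel_left, inner_neg_right] at this
  have hpv : 0 ≤ ⟪p, v⟫ := by
    refine ge_of_tendsto
      ((hasDerivAt_iff_tendsto_slope.1 hp).inner (hasDerivAt_iff_tendsto_slope.1 hv))
      (Eventually.of_forall fun t' => ?_)
    rw [slope_def_module, slope_def_module, real_inner_smul_left, real_inner_smul_right, ← mul_assoc]
    exact mul_nonneg (mul_self_nonneg _) (hF _ (hYC t') _ (hYC t))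
  have hh : HasDerivAt (fun t' => ⟪F (Y t'), Y t' - (Y t + v)⟫)
      (⟪F (Y t), v⟫ + ⟪p, Y t - (Y t + v)⟫) t := hp.inner ℝ (hv.sub_const _)
  have hmin : IsLocalMin (fun t' => gap C F (Y t') - ⟪F (Y t'), Y t' - (Y t + v)⟫) t := by
    refine Eventually.of_forall fun t' => ?_
    have h1 := inner_le_gap (F := F) hC (Y t') hw.1
    simp only [sub_add_cancel_left, inner_neg_right, hgap]
    linarith
  have := hmin.hasDerivAt_eq_zero (hφ.sub hh)
  rw [sub_add_cancel_left, inner_neg_right] at this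
  linarith

theorem antitone_of_ae_deriv_nonpos {f : ℝ → ℝ} {L : ℝ≥0} (hf : LipschitzWith L f)
    (h : ∀ᵐ t, deriv f t ≤ 0) : Antitone f := by
  intro a b hab
  have h1 := (hf.lipschitzOnWith (s := uIcc a b)).absolutelyContinuousOnInterval.integral_deriv_eq_sub
  have h2 : ∫ t in a..b, deriv f t ≤ 0 := by
    rw [intervalIntegral.integral_of_le hab]
    exact integral_nonpos_of_ae (ae_restrict_of_ae h)
  linarith

/-- If the gap is nowhere larger on a limit curve than at its point of time `0`, it vanishes there: it is
antitone along the curve, so it is constant before time `0`, and cannot decay. -/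
theorem gap_le_zero_of_isMax_curve {c : ℝ} {K : ℝ≥0} (hC : IsCompact C) (hc : 0 ≤ c)
    (hF : LipschitzOnWith K F C) (hmono : ∀ a ∈ C, ∀ b ∈ C, 0 ≤ ⟪F a - F b, a - b⟫)
    {Y : ℝ → EuclideanSpace ℝ (Fin n)} (hYC : ∀ t, Y t ∈ C)
    (hY : ∀ t t', t ≤ t' → StepEstimate C F c (t' - t) (Y t) (Y t'))
    (hmax : ∀ t, gap C F (Y t) ≤ gap C F (Y 0)) : gap C F (Y 0) ≤ 0 := by
  obtain ⟨L, hL⟩ := exists_lipschitzOnWith_gap hC ⟨_, hYC 0⟩ hF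
  have hYlip := lipschitzWith_of_stepEstimate hc hY
  have hplip : LipschitzWith (K * c.toNNReal) (fun t => F (Y t)) :=
    lipschitzOnWith_univ.1 (hF.comp hYlip.lipschitzOnWith fun t _ => hYC t)
  have hglip : LipschitzWith (L * c.toNNReal) (fun t => gap C F (Y t)) :=
    lipschitzOnWith_univ.1 (hL.comp hYlip.lipschitzOnWith fun t _ => hYC t)
  have hdec : ∀ᵐ t, deriv (fun t => gap C F (Y t)) t ≤ -gap C F (Y t) := by
    filter_upwards [hYlip.ae_differentiableAt_real, hplip.ae_differentiableAt_real,
      hglip.ae_differentiableAt_real] with t h1 h2 h3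
    exact deriv_gap_le hC hYC hmono h1.hasDerivAt h2.hasDerivAt h3.hasDerivAt
      (add_deriv_mem_lmo hC hY h1.hasDerivAt)
  have hnonneg : ∀ t, 0 ≤ gap C F (Y t) := fun t => by
    simpa using inner_le_gap (F := F) hC (Y t) (hYC t)
  have hanti := antitone_of_ae_deriv_nonpos hglip
    (hdec.mono fun t ht => ht.trans (neg_nonpos.2 (hnonneg t)))
  have hconst : ∀ t < 0, gap C F (Y t) = gap C F (Y 0) := fun t ht =>
    le_antisymm (hmax t) (hanti ht.le)
  obtain ⟨t, ht, ht0⟩ : ∃ t : ℝ, t ∈ Iio (0 : ℝ) ∧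
      deriv (fun t => gap C F (Y t)) t ≤ -gap C F (Y t) :=
    (Measure.dense_of_ae hdec).inter_open_nonempty _ isOpen_Iio nonempty_Iio
  have hzero : deriv (fun t => gap C F (Y t)) t = 0 := by
    have : (fun t => gap C F (Y t)) =ᶠ[𝓝 t] fun _ => gap C F (Y 0) := by
      filter_upwards [isOpen_Iio.mem_nhds ht] with t' ht' using hconst t' ht'
    rw [this.deriv_eq, deriv_const]
  rw [hzero, hconst t ht] at ht0
  linarith

/-! ### Convergence of the iteration -/

theorem mem_solutionSet_of_mapClusterPt {γ : ℕ → ℝ} {x : ℕ → EuclideanSpace ℝ (Fin n)} {K : ℝ≥0}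
    (hC : IsCompact C) (hconv : Convex ℝ C) (hF : LipschitzOnWith K F C)
    (hmono : ∀ a ∈ C, ∀ b ∈ C, 0 ≤ ⟪F a - F b, a - b⟫) (hγ : IsStepSize γ)
    (hx : IsFrankWolfe C F γ x) {y : EuclideanSpace ℝ (Fin n)} (hy : MapClusterPt y atTop x) :
    y ∈ solutionSet C F := by
  have hxC := hx.mem hconv hγ
  have hclC : ∀ a, MapClusterPt a atTop x → a ∈ C := fun a ha =>
    hC.isClosed.mem_of_mapClusterPt ha (Eventually.of_forall hxC)
  have hclosed : IsClosed {a | MapClusterPt a atTop x} := isClosed_setOfPred_clusterPt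
  have hcomp : IsCompact {a | MapClusterPt a atTop x} := hC.of_isClosed_subset hclosed hclC
  obtain ⟨L, hL⟩ := exists_lipschitzOnWith_gap hC ⟨_, hclC y hy⟩ hF
  obtain ⟨m, hm, hmax⟩ := hcomp.exists_isMaxOn ⟨y, hy⟩ (hL.continuousOn.mono hclC)
  have hR : ∀ a ∈ C, ∀ b ∈ C, ‖a - b‖ ≤ Metric.diam C := fun a ha b hb => by
    rw [← dist_eq_norm]
    exact Metric.dist_le_diam_of_mem hC.isBounded ha hb
  have hc : 0 ≤ Metric.diam C + K * Metric.diam C * Metric.diam C := by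
    have := Metric.diam_nonneg (s := C)
    positivity
  obtain ⟨Y, hY0, hYcl, hY⟩ := exists_limit_curve hC hconv hR hF hγ hx hm
  have hgm : gap C F (Y 0) ≤ 0 :=
    gap_le_zero_of_isMax_curve hC hc hF hmono (fun t => hclC _ (hYcl t)) hY fun t => by
      rw [hY0]
      exact hmax (hYcl t)
  rw [hY0] at hgm
  exact mem_solutionSet_of_gap_le_zero hC (hclC y hy) ((hmax hy).trans hgm)

theorem isStepSize_one_div : IsStepSize fun k => 1 / (k : ℝ) where
  mem_Ioc k hk := by
    have : (1 : ℝ) ≤ k := by exact_mod_cast hk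
    exact ⟨by positivity, by rw [div_le_one (by positivity)]; exact this⟩
  tendsto_zero := tendsto_one_div_atTop_nhds_zero_nat
  sum_tendsto := by
    refine Real.tendsto_sum_range_one_div_nat_succ_atTop.congr fun N => ?_
    induction N with
    | zero => simp
    | succ N ih => rw [Finset.sum_range_succ, ih, Finset.sum_Icc_succ_top (by omega), Nat.cast_succ]

theorem exists_isFrankWolfe (hC : IsCompact C) (hne : C.Nonempty) (γ : ℕ → ℝ) :
    ∃ x, IsFrankWolfe C F γ x := by
  have h : ∀ p : EuclideanSpace ℝ (Fin n), ∃ s, s ∈ lmo C p := fun p => by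
    obtain ⟨s, hs, hmin⟩ := hC.exists_isMinOn hne (f := fun s => ⟪p, s⟫) (by fun_prop)
    exact ⟨s, hs, fun z hz => hmin hz⟩
  choose β hβ using h
  exact ⟨Nat.rec hne.some fun k a => a + γ (k + 1) • (β (F a) - a), hne.some_mem, _,
    fun k => ⟨hβ _, rfl⟩⟩

end

end FrankWolfeVI

theorem mainTheorem1 {n : ℕ} (C : Set (EuclideanSpace ℝ (Fin n)))
    (hC_nonempty : C.Nonempty) (hC_compact : IsCompact C) (hC_convex : Convex ℝ C)
    (F : EuclideanSpace ℝ (Fin n) → EuclideanSpace ℝ (Fin n)) (hF : ContDiffOn ℝ 1 F C)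
    (μ : ℝ) (hμ : 0 < μ) (hF_mono : FrankWolfeVI.StronglyMonotoneOn μ C F) :
    ∃ xstar : EuclideanSpace ℝ (Fin n),
      FrankWolfeVI.solutionSet C F = {xstar} ∧
      (∀ (γ : ℕ → ℝ) (x : ℕ → EuclideanSpace ℝ (Fin n)),
        FrankWolfeVI.IsStepSize γ → FrankWolfeVI.IsFrankWolfe C F γ x →
          Tendsto x atTop (𝓝 xstar)) ∧
      (∀ x : ℕ → EuclideanSpace ℝ (Fin n),
        FrankWolfeVI.IsGeneralizedFictitiousPlay C F x → Tendsto x atTop (𝓝 xstar)) := by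
  obtain ⟨K, hK⟩ := (hF.locallyLipschitzOn hC_convex).exists_lipschitzOnWith_of_compact hC_compact
  have hmono : ∀ a ∈ C, ∀ b ∈ C, 0 ≤ inner ℝ (F a - F b) (a - b) := fun a ha b hb =>
    le_trans (by positivity) (hF_mono a ha b hb)
  have hcl : ∀ (γ : ℕ → ℝ) (x : ℕ → EuclideanSpace ℝ (Fin n)),
      FrankWolfeVI.IsStepSize γ → FrankWolfeVI.IsFrankWolfe C F γ x →
      ∀ y, MapClusterPt y atTop x → y ∈ FrankWolfeVI.solutionSet C F := fun γ x hγ hx y hy =>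
    FrankWolfeVI.mem_solutionSet_of_mapClusterPt hC_compact hC_convex hK hmono hγ hx hy
  have hsub := FrankWolfeVI.StronglyMonotoneOn.solutionSet_subsingleton hμ hF_mono
  obtain ⟨xstar, hstar⟩ : (FrankWolfeVI.solutionSet C F).Nonempty := by
    obtain ⟨x, hx⟩ := FrankWolfeVI.exists_isFrankWolfe (F := F) hC_compact hC_nonempty
      fun k => 1 / (k : ℝ)
    have hxC := hx.mem hC_convex FrankWolfeVI.isStepSize_one_div
    obtain ⟨y, -, hy⟩ := hC_compact.exists_mapClusterPt (f := atTop) (u := x)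
      (le_principal_iff.2 (Filter.univ_mem' (f := atTop) hxC))
    exact ⟨y, hcl _ x FrankWolfeVI.isStepSize_one_div hx y hy⟩
  have hconv : ∀ (γ : ℕ → ℝ) (x : ℕ → EuclideanSpace ℝ (Fin n)),
      FrankWolfeVI.IsStepSize γ → FrankWolfeVI.IsFrankWolfe C F γ x →
      Tendsto x atTop (𝓝 xstar) := fun γ x hγ hx =>
    hC_compact.le_nhds_of_unique_clusterPt
      (Eventually.of_forall (hx.mem hC_convex hγ) : ∀ᶠ k in atTop, x k ∈ C)
      fun y _ hy => hsub (hcl γ x hγ hx y hy) hstar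
  exact ⟨xstar, hsub.eq_singleton_of_mem hstar, hconv,
    fun x hx => hconv _ x FrankWolfeVI.isStepSize_one_div hx⟩
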